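/- Let $k$ be an algebraically closed field of characteristic $p>0$, and let $\mathbb{G}_a\rtimes\mathbb{G}_m$ have the product $(t_1,z_1)(t_2,z_2)=(t_1+z_1^2t_2,\;z_1z_2)$. Identify $(t,z)$ with the matrix $\begin{pmatrix}a&b\\0&d\end{pmatrix}\in\mathrm{SL}(2,k)$, where $a=z$, $b=tz^{-1}$, $d=z^{-1}$. A representation $\varphi:\mathbb{G}_a\rtimes\mathbb{G}_m\to\mathrm{SL}(3,k)$ is a homomorphism of algebraic groups. Two representations $\varphi,\psi$ are equivalent ($\varphi\sim\psi$) if there is $P\in\mathrm{GL}(3,k)$ with $P^{-1}\varphi(g)P=\psi(g)$ for all $g$. Let $\Lambda^*=\{\mathrm{I},\mathrm{II},\dots,\mathrm{XII}\}$. For $\lambda\in\Lambda^*$ let $R^*(\lambda)$ be the set of all representations $\varphi$ of form $\lambda$. This means that there are integers $\ell_1,\ell_2,\ell_3$ with $\ell_1+\ell_2+\ell_3=0$, and integers $e_1,e_2\ge 0$ as far as they occur, such that $\varphi\begin{pmatrix}a&b\\0&d\end{pmatrix}$ is, for all $(t,z)$, the matrix given below. (Since $ad=1$, $a^{\ell}=d^{-\ell}$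 for every integer $\ell$.) Forms with $\ell_1>\ell_2>\ell_3$ and $\ell_1>0>\ell_3$: - I: $p\ge 3$, $(\ell_1,\ell_2,\ell_3)=(2p^{e_1},0,-2p^{e_1})$, $\begin{pmatrix}a^{\ell_1}&a^{p^{e_1}}b^{p^{e_1}}&\tfrac12 b^{2p^{e_1}}\\0&a^{\ell_2}&b^{p^{e_1}}d^{p^{e_1}}\\0&0&a^{\ell_3}\end{pmatrix}$. - II: $\begin{pmatrix}a^{\ell_1}&0&0\\0&a^{\ell_2}&0\\0&0&d^{-\ell_3}\end{pmatrix}$. - III: $\ell_1-\ell_2=2p^{e_1}$, $\begin{pmatrix}a^{\ell_1}&a^{\ell_2}a^{p^{e_1}}b^{p^{e_1}}&0\\0&a^{\ell_2}&0\\0&0&d^{-\ell_3}\end{pmatrix}$. - IV: $\ell_1-\ell_3=2p^{e_2}$, $\begin{pmatrix}a^{\ell_1}&0&a^{p^{e_2}}b^{p^{e_2}}d^{-\ell_3}\\0&a^{\ell_2}&0\\0&0&d^{-\ell_3}\end{pmatrix}$. - V: $e_2>e_1\ge 0$, $(\ell_1,\ell_2,\ell_3)=\left(\tfrac{2p^{e_1}+2p^{e_2}}3,\tfrac{-4p^{e_1}+2p^{e_2}}3,\tfrac{2p^{e_1}-4p^{e_2}}3\right)$,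 $\begin{pmatrix}a^{\ell_1}&a^{\ell_1}b^{p^{e_1}}d^{p^{e_1}}&a^{\ell_1}b^{p^{e_2}}d^{p^{e_2}}\\0&a^{\ell_2}&0\\0&0&d^{-\ell_3}\end{pmatrix}$. - VI: $\ell_2-\ell_3=2p^{e_1}$, $\begin{pmatrix}a^{\ell_1}&0&0\\0&a^{\ell_2}&a^{p^{e_1}}b^{p^{e_1}}d^{-\ell_3}\\0&0&d^{-\ell_3}\end{pmatrix}$. - VII: $e_2>e_1\ge 0$, $(\ell_1,\ell_2,\ell_3)=\left(\tfrac{-2p^{e_1}+4p^{e_2}}3,\tfrac{4p^{e_1}-2p^{e_2}}3,\tfrac{-2p^{e_1}-2p^{e_2}}3\right)$, $\begin{pmatrix}a^{\ell_1}&0&a^{p^{e_2}}b^{p^{e_2}}d^{-\ell_3}\\0&d^{-\ell_2}&a^{p^{e_1}}b^{p^{e_1}}d^{-\ell_3}\\0&0&d^{-\ell_3}\end{pmatrix}$. Forms with $\ell_1=\ell_2>0>\ell_3$: - VIII: $\begin{pmatrix}a^{\ell_1}&0&0\\0&a^{\ell_1}&0\\0&0&d^{-\ell_3}\end{pmatrix}$.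 - IX: $\ell_1-\ell_3=2p^{e_1}$, $\begin{pmatrix}a^{\ell_1}&0&0\\0&a^{\ell_1}&a^{\ell_1}b^{p^{e_1}}d^{p^{e_1}}\\0&0&d^{-\ell_3}\end{pmatrix}$. Forms with $\ell_1>0>\ell_2=\ell_3$: - X: $\begin{pmatrix}a^{\ell_1}&0&0\\0&d^{-\ell_2}&0\\0&0&d^{-\ell_2}\end{pmatrix}$. - XI: $\ell_1-\ell_2=2p^{e_1}$, $\begin{pmatrix}a^{\ell_1}&a^{\ell_1}b^{p^{e_1}}d^{p^{e_1}}&0\\0&d^{-\ell_2}&0\\0&0&d^{-\ell_2}\end{pmatrix}$. Form with $\ell_1=\ell_2=\ell_3=0$: - XII: the trivial representation (the identity matrix). Then the map $$\coprod_{\lambda\in\Lambda^*}R^*(\lambda)\;\longrightarrow\;\{\varphi:\mathbb{G}_a\rtimes\mathbb{G}_m\to\mathrm{SL}(3,k)\mid\varphi\text{ is a representation}\}/\sim$$ which sends a representation $\varphi^*\in R^*(\lambda)$ to its equivalence class $[\varphi^*]$ is a bijection. -/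

import Mathlib

namespace GaGm

/-- The action of `𝔾ₘ = kˣ` on `𝔾ₐ = (k, +)` given by `σ_z(t) = z² t`. The additive group is
written multiplicatively, as Mathlib's semidirect product requires. -/
def sigma (k : Type*) [Field k] : kˣ →* MulAut (Multiplicative k) where
  toFun z := AddEquiv.toMultiplicative (DistribMulAction.toAddEquiv k (z ^ 2))
  map_one' := by
    ext t
    apply Multiplicative.toAdd.injective
    simp
  map_mul' z w := by
    ext t
    apply Multiplicative.toAdd.injective
    simp [mul_pow, mul_smul]

/-- The group of `k`-points of `𝔾ₐ ⋊ 𝔾ₘ`. -/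
abbrev Grp (k : Type*) [Field k] : Type _ := Multiplicative k ⋊[sigma k] kˣ

/-- The element `(t, z)` of `𝔾ₐ ⋊ 𝔾ₘ`. -/
def elt {k : Type*} [Field k] (t : k) (z : kˣ) : Grp k := ⟨Multiplicative.ofAdd t, z⟩

/-- The product of `𝔾ₐ ⋊ 𝔾ₘ` is `(t₁, z₁) (t₂, z₂) = (t₁ + z₁² t₂, z₁ z₂)`. -/
theorem elt_mul {k : Type*} [Field k] (t₁ t₂ : k) (z₁ z₂ : kˣ) :
    elt t₁ z₁ * elt t₂ z₂ = elt (t₁ + (z₁ : k) ^ 2 * t₂) (z₁ * z₂) := by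
  apply SemidirectProduct.ext
  · apply Multiplicative.toAdd.injective
    change t₁ + (z₁ ^ 2) • t₂ = t₁ + (z₁ : k) ^ 2 * t₂
    rw [Units.smul_def, Units.val_pow_eq_pow_val, smul_eq_mul]
  · rfl

/-- Regular functions on the variety `𝔾ₐ × 𝔾ₘ`: those given by an element of the coordinate ring
`k[T, Z, Z⁻¹]`, i.e. by a polynomial in `t`, `z` and `z⁻¹`. -/
def IsRegular {k : Type*} [Field k] (f : Grp k → k) : Prop :=
  ∃ P : MvPolynomial (Fin 3) k, ∀ (t : k) (z : kˣ),
    f (elt t z) = MvPolynomial.eval ![t, (z : k), (z : k)⁻¹] P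

/-- Representations `𝔾ₐ ⋊ 𝔾ₘ → SL(3, k)` of algebraic groups (over an algebraically closed field
`k`): group homomorphisms on `k`-points all of whose matrix entries are regular functions. -/
structure Rep (k : Type*) [Field k] where
  toHom : Grp k →* Matrix.SpecialLinearGroup (Fin 3) k
  regular : ∀ i j : Fin 3, IsRegular fun g => (toHom g : Matrix (Fin 3) (Fin 3) k) i j

/-- The matrix `φ(g)`. -/
def Rep.mat {k : Type*} [Field k] (φ : Rep k) (g : Grp k) : Matrix (Fin 3) (Fin 3) k :=
  (φ.toHom g : Matrix (Fin 3) (Fin 3) k)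

/-- Equivalence of representations into `SL(3, k)`: conjugation by one matrix of `GL(3, k)`. -/
def Rep.Equivalent {k : Type*} [Field k] (φ ψ : Rep k) : Prop :=
  ∃ P : Matrix.GeneralLinearGroup (Fin 3) k, ∀ g : Grp k,
    ((P⁻¹ : Matrix.GeneralLinearGroup (Fin 3) k) : Matrix (Fin 3) (Fin 3) k) * φ.mat g *
      (P : Matrix (Fin 3) (Fin 3) k) = ψ.mat g

theorem Rep.equivalent_equivalence (k : Type*) [Field k] :
    Equivalence (Rep.Equivalent (k := k)) where
  refl φ := ⟨1, fun g => by simp⟩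
  symm := by
    rintro φ ψ ⟨P, hP⟩
    refine ⟨P⁻¹, fun g => ?_⟩
    have h1 : (P : Matrix (Fin 3) (Fin 3) k) *
        ((P⁻¹ : Matrix.GeneralLinearGroup (Fin 3) k) : Matrix (Fin 3) (Fin 3) k) = 1 :=
      Units.mul_inv P
    rw [← hP g, inv_inv]
    simp only [Matrix.mul_assoc, h1, Matrix.mul_one]
    rw [← Matrix.mul_assoc, h1, Matrix.one_mul]
  trans := by
    rintro φ ψ χ ⟨P, hP⟩ ⟨Q, hQ⟩
    refine ⟨P * Q, fun g => ?_⟩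
    rw [← hQ g, ← hP g, mul_inv_rev, Units.val_mul, Units.val_mul]
    simp only [Matrix.mul_assoc]

/-- Representations up to equivalence. -/
def Rep.setoid (k : Type*) [Field k] : Setoid (Rep k) :=
  ⟨Rep.Equivalent, Rep.equivalent_equivalence k⟩

/-- `φ` is given by the matrix `M a b d`, where `(t, z)` is identified with the upper triangular
matrix of `SL(2, k)` with rows `(a, b)` and `(0, d)`, that is
`a = z`, `b = t z⁻¹`, `d = z⁻¹`. -/
def Rep.GivenBy {k : Type*} [Field k] (φ : Rep k)
    (M : k → k → k → Matrix (Fin 3) (Fin 3) k) : Prop :=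
  ∀ (t : k) (z : kˣ), φ.mat (elt t z) = M (z : k) (t * (z : k)⁻¹) ((z : k)⁻¹)

/-- The labels of the twelve normal forms. -/
inductive NormalForm : Type
  | I | II | III | IV | V | VI | VII | VIII | IX | X | XI | XII

/-- Standing condition on the weights for the forms I to VII. -/
def Weights₁ (l₁ l₂ l₃ : ℤ) : Prop :=
  l₁ + l₂ + l₃ = 0 ∧ l₁ > l₂ ∧ l₂ > l₃ ∧ l₁ > 0 ∧ 0 > l₃

/-- Standing condition on the weights for the forms VIII and IX. -/
def Weights₂ (l₁ l₂ l₃ : ℤ) : Prop :=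
  l₁ + l₂ + l₃ = 0 ∧ l₁ = l₂ ∧ l₂ > 0 ∧ 0 > l₃

/-- Standing condition on the weights for the forms X and XI. -/
def Weights₃ (l₁ l₂ l₃ : ℤ) : Prop :=
  l₁ + l₂ + l₃ = 0 ∧ l₁ > 0 ∧ 0 > l₂ ∧ l₂ = l₃

/-- `φ.HasForm p lam`: the representation `φ` has the form `lam`. Powers with integer exponents are
taken in `k`; as `a d = 1`, the expressions `a ^ l` and `d ^ (-l)` are the same function, so that
the sign of `l₂` need not be distinguished. -/
def Rep.HasForm {k : Type*} [Field k] (p : ℕ) (φ : Rep k) : NormalForm → Prop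
  | .I => 3 ≤ p ∧ ∃ l₁ l₂ l₃ : ℤ, Weights₁ l₁ l₂ l₃ ∧ ∃ e₁ : ℕ,
      (l₁ = 2 * (p : ℤ) ^ e₁ ∧ l₂ = 0 ∧ l₃ = -2 * (p : ℤ) ^ e₁) ∧
      φ.GivenBy fun a b d =>
        !![a ^ l₁, a ^ (p ^ e₁) * b ^ (p ^ e₁), (2 : k)⁻¹ * b ^ (2 * p ^ e₁);
           0, a ^ l₂, b ^ (p ^ e₁) * d ^ (p ^ e₁);
           0, 0, a ^ l₃]
  | .II => ∃ l₁ l₂ l₃ : ℤ, Weights₁ l₁ l₂ l₃ ∧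
      φ.GivenBy fun a _ d =>
        !![a ^ l₁, 0, 0;
           0, a ^ l₂, 0;
           0, 0, d ^ (-l₃)]
  | .III => ∃ l₁ l₂ l₃ : ℤ, Weights₁ l₁ l₂ l₃ ∧ ∃ e₁ : ℕ,
      l₁ - l₂ = 2 * (p : ℤ) ^ e₁ ∧
      φ.GivenBy fun a b d =>
        !![a ^ l₁, a ^ l₂ * a ^ (p ^ e₁) * b ^ (p ^ e₁), 0;
           0, a ^ l₂, 0;
           0, 0, d ^ (-l₃)]
  | .IV => ∃ l₁ l₂ l₃ : ℤ, Weights₁ l₁ l₂ l₃ ∧ ∃ e₂ : ℕ,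
      l₁ - l₃ = 2 * (p : ℤ) ^ e₂ ∧
      φ.GivenBy fun a b d =>
        !![a ^ l₁, 0, a ^ (p ^ e₂) * b ^ (p ^ e₂) * d ^ (-l₃);
           0, a ^ l₂, 0;
           0, 0, d ^ (-l₃)]
  | .V => ∃ l₁ l₂ l₃ : ℤ, Weights₁ l₁ l₂ l₃ ∧ ∃ e₁ e₂ : ℕ, e₂ > e₁ ∧
      (3 * l₁ = 2 * (p : ℤ) ^ e₁ + 2 * (p : ℤ) ^ e₂ ∧
        3 * l₂ = -4 * (p : ℤ) ^ e₁ + 2 * (p : ℤ) ^ e₂ ∧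
        3 * l₃ = 2 * (p : ℤ) ^ e₁ - 4 * (p : ℤ) ^ e₂) ∧
      φ.GivenBy fun a b d =>
        !![a ^ l₁, a ^ l₁ * b ^ (p ^ e₁) * d ^ (p ^ e₁), a ^ l₁ * b ^ (p ^ e₂) * d ^ (p ^ e₂);
           0, a ^ l₂, 0;
           0, 0, d ^ (-l₃)]
  | .VI => ∃ l₁ l₂ l₃ : ℤ, Weights₁ l₁ l₂ l₃ ∧ ∃ e₁ : ℕ,
      l₂ - l₃ = 2 * (p : ℤ) ^ e₁ ∧
      φ.GivenBy fun a b d =>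
        !![a ^ l₁, 0, 0;
           0, a ^ l₂, a ^ (p ^ e₁) * b ^ (p ^ e₁) * d ^ (-l₃);
           0, 0, d ^ (-l₃)]
  | .VII => ∃ l₁ l₂ l₃ : ℤ, Weights₁ l₁ l₂ l₃ ∧ ∃ e₁ e₂ : ℕ, e₂ > e₁ ∧
      (3 * l₁ = -2 * (p : ℤ) ^ e₁ + 4 * (p : ℤ) ^ e₂ ∧
        3 * l₂ = 4 * (p : ℤ) ^ e₁ - 2 * (p : ℤ) ^ e₂ ∧
        3 * l₃ = -2 * (p : ℤ) ^ e₁ - 2 * (p : ℤ) ^ e₂) ∧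
      φ.GivenBy fun a b d =>
        !![a ^ l₁, 0, a ^ (p ^ e₂) * b ^ (p ^ e₂) * d ^ (-l₃);
           0, d ^ (-l₂), a ^ (p ^ e₁) * b ^ (p ^ e₁) * d ^ (-l₃);
           0, 0, d ^ (-l₃)]
  | .VIII => ∃ l₁ l₂ l₃ : ℤ, Weights₂ l₁ l₂ l₃ ∧
      φ.GivenBy fun a _ d =>
        !![a ^ l₁, 0, 0;
           0, a ^ l₁, 0;
           0, 0, d ^ (-l₃)]
  | .IX => ∃ l₁ l₂ l₃ : ℤ, Weights₂ l₁ l₂ l₃ ∧ ∃ e₁ : ℕ,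
      l₁ - l₃ = 2 * (p : ℤ) ^ e₁ ∧
      φ.GivenBy fun a b d =>
        !![a ^ l₁, 0, 0;
           0, a ^ l₁, a ^ l₁ * b ^ (p ^ e₁) * d ^ (p ^ e₁);
           0, 0, d ^ (-l₃)]
  | .X => ∃ l₁ l₂ l₃ : ℤ, Weights₃ l₁ l₂ l₃ ∧
      φ.GivenBy fun a _ d =>
        !![a ^ l₁, 0, 0;
           0, d ^ (-l₂), 0;
           0, 0, d ^ (-l₂)]
  | .XI => ∃ l₁ l₂ l₃ : ℤ, Weights₃ l₁ l₂ l₃ ∧ ∃ e₁ : ℕ,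
      l₁ - l₂ = 2 * (p : ℤ) ^ e₁ ∧
      φ.GivenBy fun a b d =>
        !![a ^ l₁, a ^ l₁ * b ^ (p ^ e₁) * d ^ (p ^ e₁), 0;
           0, d ^ (-l₂), 0;
           0, 0, d ^ (-l₂)]
  | .XII => φ.GivenBy fun _ _ _ => 1

/-- The set `R*(lam)` of all representations with the form `lam`. -/
def RStar (k : Type*) [Field k] (p : ℕ) (lam : NormalForm) : Set (Rep k) :=
  {φ | φ.HasForm p lam}

/-- The map from the disjoint union of the sets `R*(lam)` to the set of equivalence classes of
representations which sends a representation to its class. -/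
def classMap (k : Type*) [Field k] (p : ℕ) :
    (Σ lam : NormalForm, RStar k p lam) → Quotient (Rep.setoid k) :=
  fun x => Quotient.mk (Rep.setoid k) x.2.1

end GaGm

namespace GaGm

/-! Everything is measured against one matrix shape, `stdMat`: sorted weights on the diagonal and
monomial entries with coefficients x, y, w above it. `Rep.hasForm_iff` rewrites each of the twelve
forms as this shape with fixed coefficients (`coeffs`) and a condition on the weights (`Adm`).
Surjectivity: the torus is diagonalizable, so a conjugation makes it diagonal with decreasing
weights. The relation (0,z)(t,1) = (z²t,1)(0,z) makes each entry of φ(t,1) a monomial of degree half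
the difference of two weights. The homomorphism property in t makes the (1,2) and (2,3) monomials
additive, hence of degree a power of p, and controls the (1,3) entry (`Rep.exists_isStd`).
Conjugations preserving the weight spaces then normalize x, y, w (`Rep.IsStd.exists_normalForm`).
Injectivity: an intertwiner respects weight spaces, so the weights are invariants. If they are
distinct, the intertwiner is diagonal and preserves which of x, y, w vanish; otherwise it suffices
to know whether φ(1,1) is the identity. Weights and form together determine the matrices. -/

variable {k : Type*} [Field k]

/-! ### Standard matrices and the twelve forms -/

/-- Half the difference of two weights. -/
def halfDiff (m n : ℤ) : ℕ := ((m - n) / 2).toNat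

theorem halfDiff_of_eq {m n : ℤ} {q : ℕ} (h : m - n = 2 * (q : ℤ)) : halfDiff m n = q := by
  rw [halfDiff, h, Int.mul_ediv_cancel_left _ two_ne_zero, Int.toNat_natCast]

/-- The upper triangular matrix with weights `l₁, l₂, l₃` on the diagonal and coefficients
`x, y, w` in positions `(1, 2), (1, 3), (2, 3)`. -/
def stdMat (l₁ l₂ l₃ : ℤ) (x y w t : k) (z : kˣ) : Matrix (Fin 3) (Fin 3) k :=
  !![(z : k) ^ l₁, x * t ^ halfDiff l₁ l₂ * (z : k) ^ l₂, y * t ^ halfDiff l₁ l₃ * (z : k) ^ l₃;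
     0, (z : k) ^ l₂, w * t ^ halfDiff l₂ l₃ * (z : k) ^ l₃;
     0, 0, (z : k) ^ l₃]

/-- The representation `φ` is given by `stdMat`. -/
def Rep.IsStd (φ : Rep k) (l₁ l₂ l₃ : ℤ) (x y w : k) : Prop :=
  ∀ (t : k) (z : kˣ), φ.mat (elt t z) = stdMat l₁ l₂ l₃ x y w t z

theorem Rep.ext_mat {φ ψ : Rep k} (h : ∀ (t : k) (z : kˣ), φ.mat (elt t z) = ψ.mat (elt t z)) :
    φ = ψ := by
  have h1 : φ.toHom = ψ.toHom := by
    ext g : 1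
    apply Subtype.ext
    exact h (Multiplicative.toAdd g.left) g.right
  cases φ
  cases ψ
  congr

theorem Rep.IsStd.eq {φ ψ : Rep k} {l₁ l₂ l₃ : ℤ} {x y w : k} (h : φ.IsStd l₁ l₂ l₃ x y w)
    (h' : ψ.IsStd l₁ l₂ l₃ x y w) : φ = ψ :=
  Rep.ext_mat fun t z => (h t z).trans (h' t z).symm

/-- The coefficients of a normal form. -/
def NormalForm.coeffs (k : Type*) [Field k] : NormalForm → k × k × k
  | .I => (1, 2⁻¹, 1)
  | .II => (0, 0, 0)
  | .III => (1, 0, 0)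
  | .IV => (0, 1, 0)
  | .V => (1, 1, 0)
  | .VI => (0, 0, 1)
  | .VII => (0, 1, 1)
  | .VIII => (0, 0, 0)
  | .IX => (0, 0, 1)
  | .X => (0, 0, 0)
  | .XI => (1, 0, 0)
  | .XII => (0, 0, 0)

/-- The condition on the weights in a normal form. -/
def NormalForm.Adm (p : ℕ) (l₁ l₂ l₃ : ℤ) : NormalForm → Prop
  | .I => Weights₁ l₁ l₂ l₃ ∧ 3 ≤ p ∧ l₂ = 0 ∧ ∃ e : ℕ, l₁ - l₂ = 2 * (p : ℤ) ^ e
  | .II => Weights₁ l₁ l₂ l₃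
  | .III => Weights₁ l₁ l₂ l₃ ∧ ∃ e : ℕ, l₁ - l₂ = 2 * (p : ℤ) ^ e
  | .IV => Weights₁ l₁ l₂ l₃ ∧ ∃ e : ℕ, l₁ - l₃ = 2 * (p : ℤ) ^ e
  | .V => Weights₁ l₁ l₂ l₃ ∧
      ∃ e f : ℕ, l₁ - l₂ = 2 * (p : ℤ) ^ e ∧ l₁ - l₃ = 2 * (p : ℤ) ^ f
  | .VI => Weights₁ l₁ l₂ l₃ ∧ ∃ e : ℕ, l₂ - l₃ = 2 * (p : ℤ) ^ e
  | .VII => Weights₁ l₁ l₂ l₃ ∧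
      ∃ e f : ℕ, l₂ - l₃ = 2 * (p : ℤ) ^ e ∧ l₁ - l₃ = 2 * (p : ℤ) ^ f
  | .VIII => Weights₂ l₁ l₂ l₃
  | .IX => Weights₂ l₁ l₂ l₃ ∧ ∃ e : ℕ, l₁ - l₃ = 2 * (p : ℤ) ^ e
  | .X => Weights₃ l₁ l₂ l₃
  | .XI => Weights₃ l₁ l₂ l₃ ∧ ∃ e : ℕ, l₁ - l₂ = 2 * (p : ℤ) ^ e
  | .XII => l₁ = 0 ∧ l₂ = 0 ∧ l₃ = 0

theorem zpow_mul_pow_mul_pow (t : k) (z : kˣ) (l : ℤ) (q : ℕ) :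
    (z : k) ^ l * (z : k) ^ q * (t * (z : k)⁻¹) ^ q = t ^ q * (z : k) ^ l := by
  rw [mul_assoc, ← mul_pow, mul_comm t, mul_inv_cancel_left₀ z.ne_zero, mul_comm]

theorem pow_mul_pow_mul_inv_zpow (t : k) (z : kˣ) (l : ℤ) (q : ℕ) :
    (z : k) ^ q * (t * (z : k)⁻¹) ^ q * (z : k) ^ l = t ^ q * (z : k) ^ l := by
  rw [← mul_pow, mul_comm t, mul_inv_cancel_left₀ z.ne_zero]

/-- Since bd = tz⁻², the factor (bd)^q lowers the weight by 2q, from l to m. -/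
theorem zpow_mul_pow_mul_inv_pow (t : k) (z : kˣ) {l m : ℤ} {q : ℕ} (h : l - m = 2 * (q : ℤ)) :
    (z : k) ^ l * (t * (z : k)⁻¹) ^ q * (z : k)⁻¹ ^ q = t ^ q * (z : k) ^ m := by
  have hz := z.ne_zero
  obtain rfl : l = m + q + q := by linarith
  rw [zpow_add₀ hz, zpow_add₀ hz, zpow_natCast, mul_pow, inv_pow]
  field_simp

theorem inv_zpow_neg' (a : k) (l : ℤ) : a⁻¹ ^ (-l) = a ^ l := by
  rw [inv_zpow', neg_neg]

theorem Rep.givenBy_iff_isStd (φ : Rep k) {M : k → k → k → Matrix (Fin 3) (Fin 3) k}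
    {l₁ l₂ l₃ : ℤ} {x y w : k}
    (h : ∀ (t : k) (z : kˣ), M (z : k) (t * (z : k)⁻¹) (z : k)⁻¹ = stdMat l₁ l₂ l₃ x y w t z) :
    φ.GivenBy M ↔ φ.IsStd l₁ l₂ l₃ x y w :=
  forall₂_congr fun t z => by rw [h]

variable {p : ℕ}

theorem exponent_lt (hp : p.Prime) {e f : ℕ} (h : (p : ℤ) ^ e < (p : ℤ) ^ f) : e < f :=
  (pow_lt_pow_iff_right₀ (by exact_mod_cast hp.one_lt)).1 h

theorem Rep.hasForm_iff (hp : p.Prime) (φ : Rep k) (lam : NormalForm) :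
    φ.HasForm p lam ↔ ∃ l₁ l₂ l₃ : ℤ, lam.Adm p l₁ l₂ l₃ ∧
      φ.IsStd l₁ l₂ l₃ (lam.coeffs k).1 (lam.coeffs k).2.1 (lam.coeffs k).2.2 := by
  have hd : ∀ {m n : ℤ} {e : ℕ}, m - n = 2 * (p : ℤ) ^ e → halfDiff m n = p ^ e :=
    fun h => halfDiff_of_eq (by exact_mod_cast h)
  cases lam
  case I =>
    have key : ∀ {l₁ l₂ l₃ : ℤ} {e : ℕ}, l₁ + l₂ + l₃ = 0 → l₂ = 0 → l₁ - l₂ = 2 * (p : ℤ) ^ e →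
        (φ.GivenBy _ ↔ φ.IsStd l₁ l₂ l₃ 1 2⁻¹ 1) := fun {l₁ l₂ l₃ e} h0 h2 h12 =>
      φ.givenBy_iff_isStd (M := fun a b d =>
        !![a ^ l₁, a ^ (p ^ e) * b ^ (p ^ e), (2 : k)⁻¹ * b ^ (2 * p ^ e);
           0, a ^ l₂, b ^ (p ^ e) * d ^ (p ^ e);
           0, 0, a ^ l₃]) fun t z => by
        have h23 : l₂ - l₃ = 2 * (p : ℤ) ^ e := by linarith
        -- With l₂ = 0 and zero sum the weights are equally spaced, so the corner has twice the
        -- degree.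
        have h13 : halfDiff l₁ l₃ = 2 * p ^ e := halfDiff_of_eq (by push_cast; linarith)
        have e1 := pow_mul_pow_mul_inv_zpow t z l₂ (p ^ e)
        have e3 := zpow_mul_pow_mul_inv_pow t z (l := 0) (m := l₃) (q := p ^ e)
          (by push_cast; linarith)
        rw [stdMat, hd h12, hd h23, h13]
        subst h2
        simp only [zpow_zero, one_mul, mul_one] at e1 e3 ⊢
        have e4 : (t * (z : k)⁻¹) ^ (2 * p ^ e) = t ^ (2 * p ^ e) * (z : k) ^ l₃ := by
          rw [two_mul, pow_add, pow_add, mul_assoc, ← e3, mul_pow, inv_pow]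
          ring
        rw [e1, e3, e4, mul_assoc]
    constructor
    · rintro ⟨hp3, l₁, l₂, l₃, hW, e, ⟨h1, h2, h3⟩, hG⟩
      have h12 : l₁ - l₂ = 2 * (p : ℤ) ^ e := by linarith
      exact ⟨l₁, l₂, l₃, ⟨hW, hp3, h2, e, h12⟩, (key hW.1 h2 h12).1 hG⟩
    · rintro ⟨l₁, l₂, l₃, ⟨hW, hp3, h2, e, h12⟩, hS⟩
      have h0 := hW.1
      exact ⟨hp3, l₁, l₂, l₃, hW, e, ⟨by linarith, h2, by linarith⟩, (key hW.1 h2 h12).2 hS⟩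
  case II =>
    refine exists_congr fun l₁ => exists_congr fun l₂ => exists_congr fun l₃ =>
      and_congr_right fun _ => φ.givenBy_iff_isStd fun t z => ?_
    simp [stdMat, NormalForm.coeffs]
  case III =>
    refine exists_congr fun l₁ => exists_congr fun l₂ => exists_congr fun l₃ => ?_
    rw [NormalForm.Adm, and_assoc, ← exists_and_right]
    refine and_congr_right fun _ => exists_congr fun e => and_congr_right fun h =>
      φ.givenBy_iff_isStd fun t z => ?_
    simp [stdMat, NormalForm.coeffs, hd h, zpow_mul_pow_mul_pow]
  case IV =>
    refine exists_congr fun l₁ => exists_congr fun l₂ => exists_congr fun l₃ => ?_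
    rw [NormalForm.Adm, and_assoc, ← exists_and_right]
    refine and_congr_right fun _ => exists_congr fun e => and_congr_right fun h =>
      φ.givenBy_iff_isStd fun t z => ?_
    simp only [stdMat, NormalForm.coeffs, hd h, inv_zpow_neg', pow_mul_pow_mul_inv_zpow, one_mul,
      zero_mul]
  case V =>
    refine exists_congr fun l₁ => exists_congr fun l₂ => exists_congr fun l₃ => ?_
    have key : ∀ {e f : ℕ}, l₁ - l₂ = 2 * (p : ℤ) ^ e → l₁ - l₃ = 2 * (p : ℤ) ^ f →
        (φ.GivenBy _ ↔ φ.IsStd l₁ l₂ l₃ 1 1 0) := fun {e f} h12 h13 =>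
      φ.givenBy_iff_isStd (M := fun a b d =>
        !![a ^ l₁, a ^ l₁ * b ^ (p ^ e) * d ^ (p ^ e), a ^ l₁ * b ^ (p ^ f) * d ^ (p ^ f);
           0, a ^ l₂, 0;
           0, 0, d ^ (-l₃)]) fun t z => by
        rw [stdMat, hd h12, hd h13,
          zpow_mul_pow_mul_inv_pow t z (q := p ^ e) (by exact_mod_cast h12),
          zpow_mul_pow_mul_inv_pow t z (q := p ^ f) (by exact_mod_cast h13)]
        simp
    constructor
    · rintro ⟨hW, e, f, hef, ⟨h1, h2, h3⟩, hG⟩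
      have h12 : l₁ - l₂ = 2 * (p : ℤ) ^ e := by linarith
      have h13 : l₁ - l₃ = 2 * (p : ℤ) ^ f := by linarith
      exact ⟨⟨hW, e, f, h12, h13⟩, (key h12 h13).1 hG⟩
    · rintro ⟨⟨hW, e, f, h12, h13⟩, hS⟩
      -- The inequality e < f is not part of `Adm`: it comes from l₂ > l₃, and the explicit weights
      -- come from the zero sum.
      obtain ⟨h0, -, h23, -⟩ := id hW
      exact ⟨hW, e, f, exponent_lt hp (by linarith),
        ⟨by linarith, by linarith, by linarith⟩, (key h12 h13).2 hS⟩
  case VI =>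
    refine exists_congr fun l₁ => exists_congr fun l₂ => exists_congr fun l₃ => ?_
    rw [NormalForm.Adm, and_assoc, ← exists_and_right]
    refine and_congr_right fun _ => exists_congr fun e => and_congr_right fun h =>
      φ.givenBy_iff_isStd fun t z => ?_
    simp only [stdMat, NormalForm.coeffs, hd h, inv_zpow_neg', pow_mul_pow_mul_inv_zpow, one_mul,
      zero_mul]
  case VII =>
    refine exists_congr fun l₁ => exists_congr fun l₂ => exists_congr fun l₃ => ?_
    have key : ∀ {e f : ℕ}, l₂ - l₃ = 2 * (p : ℤ) ^ e → l₁ - l₃ = 2 * (p : ℤ) ^ f →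
        (φ.GivenBy _ ↔ φ.IsStd l₁ l₂ l₃ 0 1 1) := fun {e f} h23 h13 =>
      φ.givenBy_iff_isStd (M := fun a b d =>
        !![a ^ l₁, 0, a ^ (p ^ f) * b ^ (p ^ f) * d ^ (-l₃);
           0, d ^ (-l₂), a ^ (p ^ e) * b ^ (p ^ e) * d ^ (-l₃);
           0, 0, d ^ (-l₃)]) fun t z => by
        simp only [stdMat, hd h23, hd h13, inv_zpow_neg', pow_mul_pow_mul_inv_zpow, one_mul,
          zero_mul]
    constructor
    · rintro ⟨hW, e, f, hef, ⟨h1, h2, h3⟩, hG⟩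
      have h23 : l₂ - l₃ = 2 * (p : ℤ) ^ e := by linarith
      have h13 : l₁ - l₃ = 2 * (p : ℤ) ^ f := by linarith
      exact ⟨⟨hW, e, f, h23, h13⟩, (key h23 h13).1 hG⟩
    · rintro ⟨⟨hW, e, f, h23, h13⟩, hS⟩
      obtain ⟨h0, h12, -, -⟩ := id hW
      exact ⟨hW, e, f, exponent_lt hp (by linarith),
        ⟨by linarith, by linarith, by linarith⟩, (key h23 h13).2 hS⟩
  case VIII =>
    refine exists_congr fun l₁ => exists_congr fun l₂ => exists_congr fun l₃ =>
      and_congr_right fun hW => φ.givenBy_iff_isStd fun t z => ?_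
    simp [stdMat, NormalForm.coeffs, hW.2.1]
  case IX =>
    refine exists_congr fun l₁ => exists_congr fun l₂ => exists_congr fun l₃ => ?_
    rw [NormalForm.Adm, and_assoc, ← exists_and_right]
    refine and_congr_right fun hW => exists_congr fun e => and_congr_right fun h =>
      φ.givenBy_iff_isStd fun t z => ?_
    rw [zpow_mul_pow_mul_inv_pow t z (q := p ^ e) (by exact_mod_cast h)]
    rw [hW.2.1] at h ⊢
    simp [stdMat, NormalForm.coeffs, hd h]
  case X =>
    refine exists_congr fun l₁ => exists_congr fun l₂ => exists_congr fun l₃ =>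
      and_congr_right fun hW => φ.givenBy_iff_isStd fun t z => ?_
    simp [stdMat, NormalForm.coeffs, hW.2.2.2]
  case XI =>
    refine exists_congr fun l₁ => exists_congr fun l₂ => exists_congr fun l₃ => ?_
    rw [NormalForm.Adm, and_assoc, ← exists_and_right]
    refine and_congr_right fun hW => exists_congr fun e => and_congr_right fun h =>
      φ.givenBy_iff_isStd fun t z => ?_
    rw [zpow_mul_pow_mul_inv_pow t z (q := p ^ e) (by exact_mod_cast h), stdMat, hd h, hW.2.2.2]
    simp [NormalForm.coeffs]
  case XII =>
    have key : φ.HasForm p .XII ↔ φ.IsStd 0 0 0 0 0 0 :=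
      φ.givenBy_iff_isStd (M := fun _ _ _ => 1) fun t z => by
        simp [stdMat, Matrix.one_fin_three]
    rw [key]
    constructor
    · exact fun h => ⟨0, 0, 0, ⟨rfl, rfl, rfl⟩, h⟩
    · rintro ⟨_, _, _, ⟨rfl, rfl, rfl⟩, h⟩
      exact h

/-! ### Invariants of equivalence and injectivity -/

theorem elt_zero_one : elt (0 : k) 1 = 1 := rfl

theorem Rep.mat_mul (φ : Rep k) (g h : Grp k) : φ.mat (g * h) = φ.mat g * φ.mat h := by
  simp [Rep.mat]

theorem Rep.mat_one (φ : Rep k) : φ.mat 1 = 1 := by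
  simp [Rep.mat]

theorem Rep.Equivalent.exists_intertwiner {φ ψ : Rep k} (h : φ.Equivalent ψ) :
    ∃ P : Matrix (Fin 3) (Fin 3) k, P.det ≠ 0 ∧ ∀ g, φ.mat g * P = P * ψ.mat g := by
  obtain ⟨P, hP⟩ := h
  refine ⟨P, (Matrix.isUnits_det_units P).ne_zero, fun g => ?_⟩
  have h1 : (P : Matrix (Fin 3) (Fin 3) k) *
      ((P⁻¹ : Matrix.GeneralLinearGroup (Fin 3) k) : Matrix (Fin 3) (Fin 3) k) = 1 :=
    Units.mul_inv P
  rw [← hP g, ← Matrix.mul_assoc, ← Matrix.mul_assoc, h1, Matrix.one_mul]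

theorem zpow_injective [Infinite k] {m n : ℤ} (h : ∀ z : kˣ, (z : k) ^ m = (z : k) ^ n) :
    m = n := by
  wlog hmn : m ≤ n generalizing m n
  · exact (this (fun z => (h z).symm) (le_of_not_ge hmn)).symm
  obtain ⟨d, rfl⟩ := Int.le.dest hmn
  rcases Nat.eq_zero_or_pos d with rfl | hd
  · simp
  exfalso
  -- The factor X makes the polynomial vanish at 0 as well, which is not a unit.
  have h1 : (Polynomial.X ^ d - 1 : Polynomial k) * Polynomial.X = 0 := by
    refine Polynomial.funext fun r => ?_
    rcases eq_or_ne r 0 with rfl | hr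
    · simp
    have h2 := h (Units.mk0 r hr)
    rw [Units.val_mk0, zpow_add₀ hr, zpow_natCast] at h2
    have h3 : r ^ d = 1 := (mul_eq_left₀ (zpow_ne_zero _ hr)).1 h2.symm
    simp [h3]
  rcases mul_eq_zero.1 h1 with h2 | h2
  · exact (Polynomial.X_pow_sub_C_ne_zero hd (1 : k)) (by simpa using h2)
  · exact Polynomial.X_ne_zero h2

theorem Rep.IsStd.mat_zero {φ : Rep k} {l₁ l₂ l₃ : ℤ} {x y w : k} (h : φ.IsStd l₁ l₂ l₃ x y w)
    (z : kˣ) : φ.mat (elt 0 z) = Matrix.diagonal ![(z : k) ^ l₁, (z : k) ^ l₂, (z : k) ^ l₃] := by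
  -- As 0 ^ 0 = 1, an off-diagonal entry of degree 0 does not vanish at t = 0 by itself; the value
  -- at the identity forces its coefficient to be 0.
  have h1 : stdMat l₁ l₂ l₃ x y w 0 1 = 1 := by rw [← h, elt_zero_one, φ.mat_one]
  have h12 := congrFun (congrFun h1 0) 1
  have h13 := congrFun (congrFun h1 0) 2
  have h23 := congrFun (congrFun h1 1) 2
  simp [stdMat] at h12 h13 h23
  rw [h]
  ext i j
  fin_cases i <;> fin_cases j <;> simp [stdMat, h12, h13, h23]

theorem Rep.IsStd.mat_one_one {φ : Rep k} {l₁ l₂ l₃ : ℤ} {x y w : k}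
    (h : φ.IsStd l₁ l₂ l₃ x y w) : φ.mat (elt 1 1) = !![1, x, y; 0, 1, w; 0, 0, 1] := by
  rw [h, stdMat]
  simp

/-- Equivalent representations in standard form with sorted weights have the same weights, and
an intertwiner respects the weight spaces. -/
theorem Rep.IsStd.weights_eq [Infinite k] {φ ψ : Rep k} {l₁ l₂ l₃ m₁ m₂ m₃ : ℤ}
    {x y w x' y' w' : k} (h : φ.IsStd l₁ l₂ l₃ x y w) (h' : ψ.IsStd m₁ m₂ m₃ x' y' w')
    (hl : l₁ ≥ l₂ ∧ l₂ ≥ l₃) (hm : m₁ ≥ m₂ ∧ m₂ ≥ m₃) {P : Matrix (Fin 3) (Fin 3) k}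
    (hP : P.det ≠ 0) (hPg : ∀ g, φ.mat g * P = P * ψ.mat g) :
    l₁ = m₁ ∧ l₂ = m₂ ∧ l₃ = m₃ ∧ ∀ i j, P i j ≠ 0 → ![l₁, l₂, l₃] i = ![m₁, m₂, m₃] j := by
  have h0 : ∀ i j, P i j ≠ 0 → ![l₁, l₂, l₃] i = ![m₁, m₂, m₃] j := by
    intro i j hij
    refine zpow_injective (k := k) fun z => ?_
    have h1 := congrFun (congrFun (hPg (elt 0 z)) i) j
    rw [h.mat_zero, h'.mat_zero, Matrix.diagonal_mul, Matrix.mul_diagonal, mul_comm] at h1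
    have h2 := mul_left_cancel₀ hij h1
    fin_cases i <;> fin_cases j <;> exact h2
  have e : ∀ i j, P i j = 0 ∨ ![l₁, l₂, l₃] i = ![m₁, m₂, m₃] j :=
    fun i j => or_iff_not_imp_left.2 (h0 i j)
  have e00 : P 0 0 = 0 ∨ l₁ = m₁ := e 0 0
  have e01 : P 0 1 = 0 ∨ l₁ = m₂ := e 0 1
  have e02 : P 0 2 = 0 ∨ l₁ = m₃ := e 0 2
  have e10 : P 1 0 = 0 ∨ l₂ = m₁ := e 1 0
  have e11 : P 1 1 = 0 ∨ l₂ = m₂ := e 1 1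
  have e12 : P 1 2 = 0 ∨ l₂ = m₃ := e 1 2
  have e20 : P 2 0 = 0 ∨ l₃ = m₁ := e 2 0
  have e21 : P 2 1 = 0 ∨ l₃ = m₂ := e 2 1
  have e22 : P 2 2 = 0 ∨ l₃ = m₃ := e 2 2
  -- A nonzero term of the Leibniz expansion of det P would match the l's with a permutation of the
  -- m's, and sorted triples that are permutations of each other coincide.
  have h3 : l₁ = m₁ ∧ l₂ = m₂ ∧ l₃ = m₃ := by
    by_contra hne
    apply hP
    rw [Matrix.det_fin_three]
    have t0 : P 0 0 * P 1 1 * P 2 2 = 0 := by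
      rcases e00 with r | r <;> [simp [r]; skip]
      rcases e11 with s | s <;> [simp [s]; skip]
      rcases e22 with u | u <;> [simp [u]; omega]
    have t1 : P 0 0 * P 1 2 * P 2 1 = 0 := by
      rcases e00 with r | r <;> [simp [r]; skip]
      rcases e12 with s | s <;> [simp [s]; skip]
      rcases e21 with u | u <;> [simp [u]; omega]
    have t2 : P 0 1 * P 1 0 * P 2 2 = 0 := by
      rcases e01 with r | r <;> [simp [r]; skip]
      rcases e10 with s | s <;> [simp [s]; skip]
      rcases e22 with u | u <;> [simp [u]; omega]
    have t3 : P 0 1 * P 1 2 * P 2 0 = 0 := by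
      rcases e01 with r | r <;> [simp [r]; skip]
      rcases e12 with s | s <;> [simp [s]; skip]
      rcases e20 with u | u <;> [simp [u]; omega]
    have t4 : P 0 2 * P 1 0 * P 2 1 = 0 := by
      rcases e02 with r | r <;> [simp [r]; skip]
      rcases e10 with s | s <;> [simp [s]; skip]
      rcases e21 with u | u <;> [simp [u]; omega]
    have t5 : P 0 2 * P 1 1 * P 2 0 = 0 := by
      rcases e02 with r | r <;> [simp [r]; skip]
      rcases e11 with s | s <;> [simp [s]; skip]
      rcases e20 with u | u <;> [simp [u]; omega]
    rw [t0, t1, t2, t3, t4, t5]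
    ring
  exact ⟨h3.1, h3.2.1, h3.2.2, h0⟩

/-- A matrix conjugate to the identity is the identity; this is applied to the value at (1,1), which
displays the coefficients. -/
theorem Rep.IsStd.coeffs_eq_zero {φ ψ : Rep k} {l₁ l₂ l₃ m₁ m₂ m₃ : ℤ} {x y w : k}
    (h : φ.IsStd l₁ l₂ l₃ x y w) (h' : ψ.IsStd m₁ m₂ m₃ 0 0 0)
    (he : φ.Equivalent ψ) : x = 0 ∧ y = 0 ∧ w = 0 := by
  obtain ⟨P, hP, hPg⟩ := he.exists_intertwiner
  have h1 := hPg (elt 1 1)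
  rw [h.mat_one_one, h'.mat_one_one, ← Matrix.one_fin_three, Matrix.mul_one] at h1
  have h2 : !![1, x, y; 0, 1, w; 0, 0, 1] = (1 : Matrix (Fin 3) (Fin 3) k) := by
    have hu : IsUnit P := (Matrix.isUnit_iff_isUnit_det P).2 hP.isUnit
    exact hu.mul_right_cancel (h1.trans (Matrix.one_mul P).symm)
  have h12 := congrFun (congrFun h2 0) 1
  have h13 := congrFun (congrFun h2 0) 2
  have h23 := congrFun (congrFun h2 1) 2
  simp at h12 h13 h23
  exact ⟨h12, h13, h23⟩

/-- Distinct weights force the intertwiner to be diagonal, so it only rescales x, y, w by nonzero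
factors. -/
theorem Rep.IsStd.support_eq [Infinite k] {φ ψ : Rep k} {l₁ l₂ l₃ m₁ m₂ m₃ : ℤ}
    {x y w x' y' w' : k} (h : φ.IsStd l₁ l₂ l₃ x y w) (h' : ψ.IsStd m₁ m₂ m₃ x' y' w')
    (hl : l₁ > l₂ ∧ l₂ > l₃) (hm : m₁ > m₂ ∧ m₂ > m₃) (he : φ.Equivalent ψ) :
    (x = 0 ↔ x' = 0) ∧ (y = 0 ↔ y' = 0) ∧ (w = 0 ↔ w' = 0) := by
  obtain ⟨P, hP, hPg⟩ := he.exists_intertwiner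
  obtain ⟨rfl, rfl, rfl, h0⟩ := h.weights_eq h' ⟨hl.1.le, hl.2.le⟩ ⟨hm.1.le, hm.2.le⟩ hP hPg
  have e : ∀ i j, ![l₁, l₂, l₃] i ≠ ![l₁, l₂, l₃] j → P i j = 0 :=
    fun i j hij => by_contra fun hc => hij (h0 i j hc)
  have e01 : P 0 1 = 0 := e 0 1 (by simp; omega)
  have e02 : P 0 2 = 0 := e 0 2 (by simp; omega)
  have e10 : P 1 0 = 0 := e 1 0 (by simp; omega)
  have e12 : P 1 2 = 0 := e 1 2 (by simp; omega)
  have e20 : P 2 0 = 0 := e 2 0 (by simp; omega)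
  have e21 : P 2 1 = 0 := e 2 1 (by simp; omega)
  have hdet : P 0 0 * P 1 1 * P 2 2 ≠ 0 := by
    rw [Matrix.det_fin_three] at hP
    simpa [e01, e02, e10, e12, e20, e21] using hP
  obtain ⟨⟨h00, h11⟩, h22⟩ : (P 0 0 ≠ 0 ∧ P 1 1 ≠ 0) ∧ P 2 2 ≠ 0 := by simpa using hdet
  have h1 := hPg (elt 1 1)
  rw [h.mat_one_one, h'.mat_one_one] at h1
  have h12 := congrFun (congrFun h1 0) 1
  have h13 := congrFun (congrFun h1 0) 2
  have h23 := congrFun (congrFun h1 1) 2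
  simp [Matrix.mul_apply, Fin.sum_univ_three, e01, e02, e10, e12, e21] at h12 h13 h23
  refine ⟨?_, ?_, ?_⟩
  · constructor
    · rintro rfl
      simpa [h00] using h12.symm
    · rintro rfl
      simpa [h11] using h12
  · constructor
    · rintro rfl
      simpa [h00] using h13.symm
    · rintro rfl
      simpa [h22] using h13
  · constructor
    · rintro rfl
      simpa [h11] using h23.symm
    · rintro rfl
      simpa [h22] using h23

theorem NormalForm.Adm.sorted {lam : NormalForm} {l₁ l₂ l₃ : ℤ} (h : lam.Adm p l₁ l₂ l₃) :
    l₁ ≥ l₂ ∧ l₂ ≥ l₃ := by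
  cases lam <;> simp only [NormalForm.Adm, Weights₁, Weights₂, Weights₃] at h <;> omega

/-- The weights separate I–VII, VIII–IX, X–XI and XII. Within the first group the vanishing pattern
of x, y, w decides, form I being the only one with x and w both nonzero; within each pair, exactly
one form has all coefficients zero. -/
theorem classMap_injective [Infinite k] (hp : p.Prime) :
    Function.Injective (classMap k p) := by
  rintro ⟨lam, φ, hφ⟩ ⟨mu, ψ, hψ⟩ h
  have he : φ.Equivalent ψ := Quotient.exact h
  have he' : ψ.Equivalent φ := (Rep.equivalent_equivalence k).symm he
  obtain ⟨l₁, l₂, l₃, ha, hs⟩ := (φ.hasForm_iff hp lam).1 hφ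
  obtain ⟨m₁, m₂, m₃, hb, ht⟩ := (ψ.hasForm_iff hp mu).1 hψ
  obtain ⟨P, hP, hPg⟩ := he.exists_intertwiner
  obtain ⟨rfl, rfl, rfl, -⟩ := hs.weights_eq ht ha.sorted hb.sorted hP hPg
  have hlm : lam = mu := by
    have k1 : l₁ > l₂ ∧ l₂ > l₃ → _ := fun hl => hs.support_eq ht hl hl he
    have k2 : mu.coeffs k = (0, 0, 0) → lam.coeffs k = (0, 0, 0) := fun h0 => by
      rw [h0] at ht
      obtain ⟨a, b, c⟩ := hs.coeffs_eq_zero ht he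
      exact Prod.ext a (Prod.ext b c)
    have k3 : lam.coeffs k = (0, 0, 0) → mu.coeffs k = (0, 0, 0) := fun h0 => by
      rw [h0] at hs
      obtain ⟨a, b, c⟩ := ht.coeffs_eq_zero hs he'
      exact Prod.ext a (Prod.ext b c)
    clear h hs ht hφ hψ hPg
    cases lam <;> cases mu <;>
      first
      | rfl
      | (exfalso
         simp only [NormalForm.Adm, Weights₁, Weights₂, Weights₃] at ha hb
         first
         | omega
         | (have := k1 (by omega)
            simp [NormalForm.coeffs] at this)
         | simp [NormalForm.coeffs] at k2 k3)
  subst hlm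
  obtain rfl := hs.eq ht
  rfl

/-! ### Conjugation of representations -/

theorem IsRegular.linearCombination {ι : Type*} (s : Finset ι) (c : ι → k) {f : ι → Grp k → k}
    (h : ∀ i, IsRegular (f i)) : IsRegular fun g => ∑ i ∈ s, c i * f i g := by
  choose P hP using h
  refine ⟨∑ i ∈ s, MvPolynomial.C (c i) * P i, fun t z => ?_⟩
  simp [hP, map_sum]

theorem Rep.mat_regular (φ : Rep k) (i j : Fin 3) : IsRegular fun g => φ.mat g i j :=
  φ.regular i j

/-- A representation conjugated by an element of `GL(3, k)`. -/
def Rep.conj (φ : Rep k) (P : Matrix.GeneralLinearGroup (Fin 3) k) : Rep k where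
  toHom :=
    { toFun := fun g => ⟨(P⁻¹).val * φ.mat g * P.val, by
        have h : (P⁻¹).val.det * P.val.det = 1 := by
          rw [← Matrix.det_mul, Units.inv_mul, Matrix.det_one]
        have h' : (φ.mat g).det = 1 := (φ.toHom g).2
        rw [Matrix.det_mul, Matrix.det_mul, h', mul_one, h]⟩
      map_one' := by
        apply Subtype.ext
        change (P⁻¹).val * φ.mat 1 * P.val = 1
        rw [φ.mat_one, Matrix.mul_one, Units.inv_mul]
      map_mul' := fun g h => by
        apply Subtype.ext
        change (P⁻¹).val * φ.mat (g * h) * P.val =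
          ((P⁻¹).val * φ.mat g * P.val) * ((P⁻¹).val * φ.mat h * P.val)
        have h1 : P.val * (P⁻¹).val = 1 := Units.mul_inv P
        calc _ = (P⁻¹).val * φ.mat g * 1 * (φ.mat h * P.val) := by
              rw [φ.mat_mul, Matrix.mul_one]
              simp only [Matrix.mul_assoc]
          _ = _ := by
              rw [← h1]
              simp only [Matrix.mul_assoc] }
  regular i j := by
    have h : ∀ g, ((P⁻¹).val * φ.mat g * P.val) i j =
        ∑ m : Fin 3 × Fin 3, (P⁻¹).val i m.1 * P.val m.2 j * φ.mat g m.1 m.2 := by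
      intro g
      rw [Fintype.sum_prod_type_right]
      simp only [Matrix.mul_apply, Finset.sum_mul]
      exact Finset.sum_congr rfl fun _ _ => Finset.sum_congr rfl fun _ _ => by ring
    change IsRegular fun g => ((P⁻¹).val * φ.mat g * P.val) i j
    simp only [h]
    exact IsRegular.linearCombination _ _ fun m => φ.mat_regular m.1 m.2

theorem Rep.equivalent_conj (φ : Rep k) (P : Matrix.GeneralLinearGroup (Fin 3) k) :
    φ.Equivalent (φ.conj P) :=
  ⟨P, fun _ => rfl⟩

/-- An intertwining matrix identity for `φ` transfers to an equivalent representation. -/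
theorem Rep.exists_equivalent (φ : Rep k) {P : Matrix (Fin 3) (Fin 3) k} (hP : P.det ≠ 0)
    {M : Grp k → Matrix (Fin 3) (Fin 3) k} {S : Set (Grp k)}
    (h : ∀ g ∈ S, φ.mat g * P = P * M g) :
    ∃ ψ : Rep k, φ.Equivalent ψ ∧ ∀ g ∈ S, ψ.mat g = M g := by
  let Q : Matrix.GeneralLinearGroup (Fin 3) k := Matrix.GeneralLinearGroup.mkOfDetNeZero P hP
  refine ⟨φ.conj Q, φ.equivalent_conj Q, fun g hg => ?_⟩
  change (Q⁻¹).val * φ.mat g * Q.val = M g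
  have h1 : φ.mat g * Q.val = Q.val * M g := h g hg
  rw [Matrix.mul_assoc, h1, ← Matrix.mul_assoc, Units.inv_mul, Matrix.one_mul]

theorem Rep.IsStd.exists_equivalent {φ : Rep k} {l₁ l₂ l₃ : ℤ} {x y w x' y' w' : k}
    (h : φ.IsStd l₁ l₂ l₃ x y w) {P : Matrix (Fin 3) (Fin 3) k} (hP : P.det ≠ 0)
    (hPg : ∀ (t : k) (z : kˣ),
      stdMat l₁ l₂ l₃ x y w t z * P = P * stdMat l₁ l₂ l₃ x' y' w' t z) :
    ∃ ψ : Rep k, φ.Equivalent ψ ∧ ψ.IsStd l₁ l₂ l₃ x' y' w' := by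
  obtain ⟨ψ, h1, h2⟩ := φ.exists_equivalent hP (S := Set.univ)
    (M := fun g => stdMat l₁ l₂ l₃ x' y' w' (Multiplicative.toAdd g.left) g.right)
    (fun g _ => by rw [← hPg, ← h]; rfl)
  exact ⟨ψ, h1, fun t z => h2 (elt t z) trivial⟩

/-! ### Diagonalization of the torus -/

/-- The value of a Laurent polynomial. -/
noncomputable def laurentEval (z : kˣ) : (ℤ →₀ k) →ₗ[k] k :=
  Finsupp.linearCombination k fun n : ℤ => (z : k) ^ n

theorem laurentEval_single (z : kˣ) (n : ℤ) (c : k) :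
    laurentEval z (Finsupp.single n c) = c * (z : k) ^ n := by
  simp [laurentEval]

theorem laurentEval_eq_sum (z : kˣ) {a : ℤ →₀ k} {s : Finset ℤ} (hs : a.support ⊆ s) :
    laurentEval z a = ∑ n ∈ s, a n * (z : k) ^ n := by
  rw [laurentEval, Finsupp.linearCombination_apply, Finsupp.sum_of_support_subset _ hs _ (by simp)]
  rfl

theorem IsRegular.exists_laurent {f : Grp k → k} (h : IsRegular f) :
    ∃ a : ℤ →₀ k, ∀ z : kˣ, f (elt 0 z) = laurentEval z a := by
  obtain ⟨P, hP⟩ := h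
  -- The factor `0 ^ d 0` keeps exactly the monomials free of T.
  refine ⟨∑ d ∈ P.support, Finsupp.single ((d 1 : ℤ) - d 2) (P.coeff d * 0 ^ d 0), fun z => ?_⟩
  rw [hP, MvPolynomial.eval_eq', map_sum]
  refine Finset.sum_congr rfl fun d _ => ?_
  rw [laurentEval_single, Fin.prod_univ_three, zpow_sub₀ z.ne_zero]
  simp [div_eq_mul_inv, mul_assoc]

theorem IsRegular.exists_polynomial {f : Grp k → k} (h : IsRegular f) :
    ∃ q : Polynomial k, ∀ t : k, f (elt t 1) = q.eval t := by
  obtain ⟨P, hP⟩ := h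
  refine ⟨∑ d ∈ P.support, Polynomial.C (P.coeff d) * Polynomial.X ^ d 0, fun t => ?_⟩
  rw [hP, MvPolynomial.eval_eq', Polynomial.eval_finsetSum]
  refine Finset.sum_congr rfl fun d _ => ?_
  simp [Fin.prod_univ_three]

/-- The character `z ↦ zⁿ` of the multiplicative group. -/
def zpowChar (k : Type*) [Field k] (n : ℤ) : kˣ →* k :=
  (Units.coeHom k).comp (zpowGroupHom n)

theorem zpowChar_apply (n : ℤ) (z : kˣ) : zpowChar k n z = (z : k) ^ n := by
  simp [zpowChar]

/-- Laurent polynomials are determined by their values. -/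
theorem laurent_ext [Infinite k] {a b : ℤ →₀ k}
    (h : ∀ z : kˣ, laurentEval z a = laurentEval z b) : a = b := by
  -- Dedekind's independence of characters.
  have h1 : LinearIndependent k fun n : ℤ => (zpowChar k n : kˣ → k) := by
    refine (linearIndependent_monoidHom kˣ k).comp (zpowChar k) fun m n hmn => ?_
    exact zpow_injective (k := k) fun z => by rw [← zpowChar_apply, hmn, zpowChar_apply]
  refine h1 (funext fun z => ?_)
  simpa [laurentEval, Finsupp.linearCombination_apply, Finsupp.sum, zpowChar_apply] using h z

theorem elt_zero_mul (z w : kˣ) : elt (0 : k) z * elt 0 w = elt 0 (z * w) := by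
  rw [elt_mul, mul_zero, add_zero]

theorem elt_one_mul_elt_zero (t : k) (z : kˣ) : elt t 1 * elt 0 z = elt t z := by
  rw [elt_mul, mul_zero, add_zero, one_mul]

theorem elt_zero_mul_elt_one (t : k) (z : kˣ) :
    elt 0 z * elt t 1 = elt ((z : k) ^ 2 * t) z := by
  rw [elt_mul, zero_add, mul_one]

theorem elt_one_mul (s t : k) : elt s 1 * elt t 1 = elt (s + t) 1 := by
  rw [elt_mul]
  simp

/-- The weight vectors of the torus span. -/
theorem Rep.span_weightVectors [Infinite k] (φ : Rep k) :
    ⊤ ≤ Submodule.span k {v : Fin 3 → k | ∃ n : ℤ, ∀ z : kˣ,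
      (φ.mat (elt 0 z)).mulVec v = (z : k) ^ n • v} := by
  choose a ha using fun i j => (φ.mat_regular i j).exists_laurent
  -- Write φ(0,w) = ∑ Aₙ wⁿ. Comparing coefficients of wⁿ in φ(0,z)φ(0,w) = φ(0,zw) gives φ(0,z)Aₙ =
  -- zⁿAₙ, so the columns of Aₙ are weight vectors.
  have h1 : ∀ (n : ℤ) (l : Fin 3) (z : kˣ),
      (φ.mat (elt 0 z)).mulVec (fun j => a j l n) = (z : k) ^ n • fun j => a j l n := by
    intro n l z
    ext i
    let b : ℤ →₀ k := Finsupp.onFinset (a i l).support (fun n => (z : k) ^ n * a i l n)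
      fun n hn => Finsupp.mem_support_iff.2 (right_ne_zero_of_mul hn)
    have h2 : ∑ j, φ.mat (elt 0 z) i j • a j l = b := by
      refine laurent_ext fun w => ?_
      rw [laurentEval_eq_sum w (a := b) Finsupp.support_onFinset_subset, map_sum]
      have h3 : ∀ n, b n * (w : k) ^ n = a i l n * ((z * w : kˣ) : k) ^ n := fun n => by
        rw [Finsupp.onFinset_apply, Units.val_mul, mul_zpow]
        ring
      simp only [h3, ← laurentEval_eq_sum (z * w) (subset_refl _), map_smul, ← ha, smul_eq_mul]
      rw [← elt_zero_mul, φ.mat_mul, Matrix.mul_apply]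
    have h4 := DFunLike.congr_fun h2 n
    rw [Finsupp.finsetSum_apply] at h4
    exact h4
  let S := Finset.univ.biUnion fun m : Fin 3 × Fin 3 => (a m.1 m.2).support
  have h5 : ∀ i l, ∑ n ∈ S, a i l n = φ.mat (elt 0 1) i l := fun i l => by
    rw [ha, laurentEval_eq_sum (s := S)]
    · simp
    · exact Finset.subset_biUnion_of_mem (fun m : Fin 3 × Fin 3 => (a m.1 m.2).support)
        (Finset.mem_univ (i, l))
  intro v _
  -- At z = 1 the matrices Aₙ sum to the identity.
  have h6 : v = ∑ l, v l • ∑ n ∈ S, fun j => a j l n := by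
    ext i
    simp only [Finset.sum_apply, Pi.smul_apply, h5, elt_zero_one, φ.mat_one, Matrix.one_apply]
    simp
  rw [h6]
  exact Submodule.sum_mem _ fun l _ => Submodule.smul_mem _ _ <| Submodule.sum_mem _ fun n _ =>
    Submodule.subset_span ⟨n, h1 n l⟩

/-- Every representation is equivalent to one whose torus is diagonal with sorted weights. -/
theorem Rep.exists_diagonal [Infinite k] (φ : Rep k) :
    ∃ (ψ : Rep k) (l : Fin 3 → ℤ), φ.Equivalent ψ ∧ Antitone l ∧
      ∀ z : kˣ, ψ.mat (elt 0 z) = Matrix.diagonal fun i => (z : k) ^ l i := by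
  let b := Module.Basis.ofSpan φ.span_weightVectors
  have hb : ∀ i, ∃ n : ℤ, ∀ z : kˣ, (φ.mat (elt 0 z)).mulVec (b i) = (z : k) ^ n • b i :=
    fun i => Module.Basis.ofSpan_subset φ.span_weightVectors ⟨i, rfl⟩
  choose n hn using hb
  let e := b.indexEquiv (Pi.basisFun k (Fin 3))
  -- `Tuple.sort` sorts increasingly; the sign makes the weights decrease.
  let σ := Tuple.sort fun i => -n (e.symm i)
  have hσ : Monotone ((fun i => -n (e.symm i)) ∘ σ) := Tuple.monotone_sort _
  let c := b.reindex (e.trans σ.symm)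
  have hc : ∀ i, c i = b (e.symm (σ i)) := fun i => by simp [c]
  have hdet : ((Pi.basisFun k (Fin 3)).toMatrix c).det ≠ 0 := by
    rw [← Module.Basis.det_apply]
    exact ((Pi.basisFun k (Fin 3)).isUnit_det c).ne_zero
  obtain ⟨ψ, h1, h2⟩ := φ.exists_equivalent hdet (S := Set.range fun z : kˣ => elt 0 z)
    (M := fun g => Matrix.diagonal fun i => (g.right : k) ^ n (e.symm (σ i))) (by
      rintro _ ⟨z, rfl⟩
      ext i j
      rw [Matrix.mul_diagonal, mul_comm]
      have h3 := congrFun (hn (e.symm (σ j)) z) i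
      rw [← hc] at h3
      exact h3)
  exact ⟨ψ, fun i => n (e.symm (σ i)), h1, fun i j hij => neg_le_neg_iff.1 (hσ hij),
    fun z => h2 _ ⟨z, rfl⟩⟩

/-! ### The unipotent part and its exponents -/

/-- The unipotent entries of a representation with diagonal torus are monomials. -/
theorem Rep.exists_monomial [Infinite k] (ψ : Rep k) {l : Fin 3 → ℤ}
    (hl : ∀ z : kˣ, ψ.mat (elt 0 z) = Matrix.diagonal fun i => (z : k) ^ l i) (i j : Fin 3) :
    ∃ c : k, (∀ t, ψ.mat (elt t 1) i j = c * t ^ halfDiff (l i) (l j)) ∧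
      (c ≠ 0 → 2 * (halfDiff (l i) (l j) : ℤ) = l i - l j) := by
  obtain ⟨q, hq⟩ := (ψ.mat_regular i j).exists_polynomial
  have h1 : ∀ (z : kˣ) (t : k), (z : k) ^ l i * q.eval t = q.eval ((z : k) ^ 2 * t) * z ^ l j := by
    intro z t
    have h2 : elt 0 z * elt t 1 = elt ((z : k) ^ 2 * t) 1 * elt 0 z := by
      rw [elt_zero_mul_elt_one, elt_one_mul_elt_zero]
    have h3 := congrFun (congrFun (congrArg ψ.mat h2) i) j
    rw [ψ.mat_mul, ψ.mat_mul, hl, Matrix.diagonal_mul, Matrix.mul_diagonal, hq, hq] at h3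
    exact h3
  have h4 : ∀ d, q.coeff d ≠ 0 → l i - l j = 2 * (d : ℤ) := by
    intro d hd
    have h5 : ∀ z : kˣ, (z : k) ^ l i = (z : k) ^ (2 * (d : ℤ) + l j) := by
      intro z
      have h6 : Polynomial.C ((z : k) ^ l i) * q =
          q.comp (Polynomial.C ((z : k) ^ 2) * Polynomial.X) * Polynomial.C ((z : k) ^ l j) :=
        Polynomial.funext fun t => by simpa using h1 z t
      have h7 := congrArg (fun r => r.coeff d) h6
      simp only [Polynomial.coeff_C_mul, Polynomial.coeff_mul_C,
        Polynomial.comp_C_mul_X_coeff] at h7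
      rw [zpow_add₀ z.ne_zero, zpow_mul, zpow_natCast]
      refine mul_right_cancel₀ hd (h7.trans ?_)
      rw [show ((z : k) ^ (2 : ℤ)) = (z : k) ^ 2 from zpow_ofNat _ 2]
      ring
    have := zpow_injective h5
    linarith
  -- If the difference of weights is odd or negative, q = 0 and this coefficient is 0, whatever
  -- value `halfDiff` takes.
  refine ⟨q.coeff (halfDiff (l i) (l j)), fun t => ?_, fun hc => (h4 _ hc).symm⟩
  rw [hq, Polynomial.eval_eq_sum, Polynomial.sum_def]
  rw [Finset.sum_eq_single (halfDiff (l i) (l j))]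
  · intro d hd hne
    exact absurd (halfDiff_of_eq (h4 d (Polynomial.mem_support_iff.1 hd))).symm hne
  · intro hd
    rw [Polynomial.notMem_support_iff.1 hd, zero_mul]

theorem pow_injective_fun [Infinite k] {m n : ℕ} (h : ∀ s : k, s ^ m = s ^ n) : m = n := by
  have h1 : (m : ℤ) = n := zpow_injective (k := k) fun z => by
    rw [zpow_natCast, zpow_natCast, h]
  exact_mod_cast h1

/-- An additive monomial function in characteristic `p` is a power of Frobenius. -/
theorem exists_eq_pow_of_additive [Infinite k] (hp : p.Prime) [CharP k p] {n : ℕ}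
    (h : ∀ s t : k, (s + t) ^ n = s ^ n + t ^ n) : ∃ e : ℕ, n = p ^ e := by
  have : Fact p.Prime := ⟨hp⟩
  have hn : n ≠ 0 := by
    rintro rfl
    simpa using h 0 0
  -- Injectivity of Frobenius strips off p^e; then the coefficient of X in (1 + X)^m = 1 + X^m gives
  -- p ∣ m unless m = 1.
  obtain ⟨e, m, hpm, rfl⟩ := Nat.exists_eq_pow_mul_and_not_dvd hn p hp.ne_one
  refine ⟨e, ?_⟩
  have h1 : ∀ r : k, (1 + r) ^ m = 1 + r ^ m := by
    intro r
    apply frobenius_inj k p |>.iterate e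
    have h2 := h 1 r
    rw [one_pow, pow_mul, pow_mul, add_pow_char_pow, one_pow] at h2
    simpa [iterate_frobenius, add_pow_char_pow, ← pow_mul, mul_comm m] using h2
  have h3 : ((1 + Polynomial.X) ^ m : Polynomial k) = 1 + Polynomial.X ^ m :=
    Polynomial.funext fun r => by simpa using h1 r
  have h4 := congrArg (fun q => q.coeff 1) h3
  simp only [Polynomial.coeff_one_add_X_pow, Nat.choose_one_right, Polynomial.coeff_add,
    Polynomial.coeff_X_pow, Polynomial.coeff_one] at h4
  by_cases hm : m = 1
  · simp [hm]
  · exfalso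
    rw [if_neg (Ne.symm hm)] at h4
    apply hpm
    rw [← CharP.cast_eq_zero_iff k p, h4]
    simp

/-- The constraints on the weights and coefficients of a representation in standard form. -/
structure StdConstraints (k : Type*) [Field k] (p : ℕ) (l₁ l₂ l₃ : ℤ) (x y w : k) : Prop where
  sum : l₁ + l₂ + l₃ = 0
  le₁₂ : l₂ ≤ l₁
  le₂₃ : l₃ ≤ l₂
  exp₁₂ : x ≠ 0 → ∃ e : ℕ, l₁ - l₂ = 2 * (p : ℤ) ^ e
  exp₂₃ : w ≠ 0 → ∃ e : ℕ, l₂ - l₃ = 2 * (p : ℤ) ^ e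
  exp₁₃ : x = 0 ∨ w = 0 → y ≠ 0 → ∃ e : ℕ, l₁ - l₃ = 2 * (p : ℤ) ^ e
  both : x ≠ 0 → w ≠ 0 → l₁ - l₂ = l₂ - l₃ ∧ p ≠ 2 ∧ y = x * w * 2⁻¹

theorem exists_eq_pow_of_coeff [Infinite k] (hp : p.Prime) [CharP k p] {m n : ℤ} {c : k}
    (hc : c ≠ 0) (h2 : 2 * (halfDiff m n : ℤ) = m - n)
    (h : ∀ s t : k, c * (s + t) ^ halfDiff m n = c * s ^ halfDiff m n + c * t ^ halfDiff m n) :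
    ∃ e : ℕ, m - n = 2 * (p : ℤ) ^ e := by
  obtain ⟨e, he⟩ := exists_eq_pow_of_additive hp fun s t =>
    mul_left_cancel₀ hc ((h s t).trans (mul_add _ _ _).symm)
  exact ⟨e, by rw [← h2, he]; push_cast; rfl⟩

theorem Rep.exists_isStd [Infinite k] (hp : p.Prime) [CharP k p] (φ : Rep k) :
    ∃ (ψ : Rep k) (l₁ l₂ l₃ : ℤ) (x y w : k), φ.Equivalent ψ ∧ ψ.IsStd l₁ l₂ l₃ x y w ∧
      StdConstraints k p l₁ l₂ l₃ x y w := by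
  have : Fact p.Prime := ⟨hp⟩
  obtain ⟨ψ, l, hψ, hanti, hD⟩ := φ.exists_diagonal
  choose c hc hc2 using ψ.exists_monomial hD
  -- A degree-0 entry is constant, equal to its value at the identity. This covers the diagonal and,
  -- as `toNat` truncates negative numbers to 0, everything below it.
  have hconst : ∀ i j, halfDiff (l i) (l j) = 0 → ∀ t,
      ψ.mat (elt t 1) i j = (1 : Matrix (Fin 3) (Fin 3) k) i j := by
    intro i j h t
    rw [← ψ.mat_one, ← elt_zero_one, hc, hc, h, pow_zero, pow_zero]
  have hdiag : ∀ i t, ψ.mat (elt t 1) i i = 1 := fun i t => by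
    rw [hconst i i (by simp [halfDiff]), Matrix.one_apply_eq]
  have hlow : ∀ i j, j < i → ∀ t, ψ.mat (elt t 1) i j = 0 := fun i j hij t => by
    rw [hconst i j, Matrix.one_apply_ne hij.ne']
    have := hanti hij.le
    rw [halfDiff, Int.toNat_eq_zero]
    omega
  have hU : ∀ t, ψ.mat (elt t 1) = !![1, c 0 1 * t ^ halfDiff (l 0) (l 1),
      c 0 2 * t ^ halfDiff (l 0) (l 2); 0, 1, c 1 2 * t ^ halfDiff (l 1) (l 2); 0, 0, 1] := by
    intro t
    ext i j
    fin_cases i <;> fin_cases j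
    · exact hdiag 0 t
    · exact hc 0 1 t
    · exact hc 0 2 t
    · exact hlow 1 0 (by decide) t
    · exact hdiag 1 t
    · exact hc 1 2 t
    · exact hlow 2 0 (by decide) t
    · exact hlow 2 1 (by decide) t
    · exact hdiag 2 t
  have hstd : ψ.IsStd (l 0) (l 1) (l 2) (c 0 1) (c 0 2) (c 1 2) := by
    intro t z
    rw [← elt_one_mul_elt_zero, ψ.mat_mul, hU, hD, stdMat]
    ext i j
    rw [Matrix.mul_diagonal]
    fin_cases i <;> fin_cases j <;> simp
  have hadd : ∀ s t : k, ψ.mat (elt (s + t) 1) = ψ.mat (elt s 1) * ψ.mat (elt t 1) := fun s t => by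
    rw [← ψ.mat_mul, elt_one_mul]
  refine ⟨ψ, l 0, l 1, l 2, c 0 1, c 0 2, c 1 2, hψ, hstd, ?_⟩
  have d01 := hc2 0 1
  have d02 := hc2 0 2
  have d12 := hc2 1 2
  generalize c 0 1 = x at *
  generalize c 0 2 = y at *
  generalize c 1 2 = w at *
  have a12 : ∀ s t : k, x * (s + t) ^ halfDiff (l 0) (l 1) =
      x * s ^ halfDiff (l 0) (l 1) + x * t ^ halfDiff (l 0) (l 1) := fun s t => by
    have h := congrFun (congrFun (hadd s t) 0) 1
    rw [hU, hU, hU] at h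
    simp [Matrix.mul_apply, Fin.sum_univ_three] at h
    rw [h, add_comm]
  have a23 : ∀ s t : k, w * (s + t) ^ halfDiff (l 1) (l 2) =
      w * s ^ halfDiff (l 1) (l 2) + w * t ^ halfDiff (l 1) (l 2) := fun s t => by
    have h := congrFun (congrFun (hadd s t) 1) 2
    rw [hU, hU, hU] at h
    simp [Matrix.mul_apply, Fin.sum_univ_three] at h
    rw [h, add_comm]
  -- The corner is additive only up to a cross term with factor xw, hence the split on whether x or
  -- w vanishes.
  have a13 : ∀ s t : k, y * (s + t) ^ halfDiff (l 0) (l 2) =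
      y * t ^ halfDiff (l 0) (l 2) + x * s ^ halfDiff (l 0) (l 1) *
        (w * t ^ halfDiff (l 1) (l 2)) + y * s ^ halfDiff (l 0) (l 2) := fun s t => by
    have h := congrFun (congrFun (hadd s t) 0) 2
    rw [hU, hU, hU] at h
    simpa [Matrix.mul_apply, Fin.sum_univ_three] using h
  refine ⟨?_, hanti (by decide), hanti (by decide), fun hx => ?_, fun hw => ?_,
    fun hxw hy => ?_, fun hx hw => ?_⟩
  · refine zpow_injective (k := k) fun z => ?_
    have h1 : (ψ.mat (elt 0 z)).det = 1 := (ψ.toHom (elt 0 z)).2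
    rw [hD, Matrix.det_diagonal, Fin.prod_univ_three] at h1
    rw [zpow_add₀ z.ne_zero, zpow_add₀ z.ne_zero, h1, zpow_zero]
  · exact exists_eq_pow_of_coeff hp hx (d01 hx) a12
  · exact exists_eq_pow_of_coeff hp hw (d12 hw) a23
  · refine exists_eq_pow_of_coeff hp hy (d02 hy) fun s t => ?_
    rw [a13]
    rcases hxw with h | h <;> rw [h] <;> ring
  · obtain ⟨e, he⟩ := exists_eq_pow_of_additive hp fun s t =>
      mul_left_cancel₀ hx ((a12 s t).trans (mul_add _ _ _).symm)
    have hxw : x * w ≠ 0 := mul_ne_zero hx hw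
    -- The left side of `a13` is symmetric in s and t, so the cross term is too; setting one
    -- variable to 1 compares the two powers.
    have hmn : halfDiff (l 0) (l 1) = halfDiff (l 1) (l 2) :=
      pow_injective_fun (k := k) fun s => by
        have h1 := a13 s 1
        have h2 := a13 1 s
        rw [add_comm 1 s] at h2
        refine mul_left_cancel₀ hxw ?_
        simp only [one_pow, mul_one] at h1 h2
        linear_combination h2 - h1
    have hl : l 0 - l 1 = l 1 - l 2 := by rw [← d01 hx, ← d12 hw, hmn]
    have h13 : halfDiff (l 0) (l 2) = p ^ e + p ^ e := halfDiff_of_eq (by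
      have := d01 hx
      rw [he] at this
      push_cast at this ⊢
      linarith)
    have hfrob : (1 + 1 : k) ^ p ^ e = 1 + 1 := by
      rw [add_pow_char_pow, one_pow]
    -- At s = t = 1 Frobenius turns `a13` into 4y = 2y + xw. As xw ≠ 0, this excludes characteristic
    -- 2.
    have h1 : y * 2 = x * w := by
      have h2 := a13 1 1
      rw [h13, pow_add, hfrob] at h2
      simp only [one_pow, mul_one] at h2
      linear_combination h2
    have h2 : (2 : k) ≠ 0 := right_ne_zero_of_mul (h1 ▸ hxw)
    refine ⟨hl, ?_, by rw [← h1, mul_inv_cancel_right₀ h2]⟩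
    rintro rfl
    exact h2 (by exact_mod_cast CharP.cast_eq_zero k 2)

/-! ### Normalization of the coefficients and surjectivity -/

theorem Rep.IsStd.exists_rescale {φ : Rep k} {l₁ l₂ l₃ : ℤ} {x y w : k}
    (h : φ.IsStd l₁ l₂ l₃ x y w) {x' y' w' : k} (d₁ d₂ d₃ : k) (hd : d₁ * d₂ * d₃ ≠ 0)
    (hx : x * d₂ = d₁ * x') (hy : y * d₃ = d₁ * y') (hw : w * d₃ = d₂ * w') :
    ∃ ψ : Rep k, φ.Equivalent ψ ∧ ψ.IsStd l₁ l₂ l₃ x' y' w' := by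
  refine h.exists_equivalent (P := Matrix.diagonal ![d₁, d₂, d₃]) ?_ fun t z => ?_
  · simpa [Fin.prod_univ_three] using hd
  · ext i j
    rw [Matrix.mul_diagonal, Matrix.diagonal_mul]
    fin_cases i <;> fin_cases j <;> simp [stdMat] <;> first
      | ring1
      | linear_combination t ^ halfDiff l₁ l₂ * (z : k) ^ l₂ * hx
      | linear_combination t ^ halfDiff l₁ l₃ * (z : k) ^ l₃ * hy
      | linear_combination t ^ halfDiff l₂ l₃ * (z : k) ^ l₃ * hw

/-- The weight l has a plane of weight vectors, and GL₂ acting on it moves the nonzero column (y, w)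
to (0, 1): the second column of P is (y, w, 0). -/
theorem Rep.IsStd.exists_column {φ : Rep k} {l m : ℤ} {y w : k} (h : φ.IsStd l l m 0 y w)
    (hyw : y ≠ 0 ∨ w ≠ 0) : ∃ ψ : Rep k, φ.Equivalent ψ ∧ ψ.IsStd l l m 0 0 1 := by
  by_cases hw : w = 0
  · have hy : y ≠ 0 := hyw.resolve_right (not_not.2 hw)
    refine h.exists_equivalent (P := !![0, y, 0; 1, 0, 0; 0, 0, 1]) ?_ fun t z => ?_
    · simpa [Matrix.det_fin_three] using hy
    · ext i j
      fin_cases i <;> fin_cases j <;>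
        simp [stdMat, Matrix.mul_apply, Fin.sum_univ_three, hw] <;> ring
  · refine h.exists_equivalent (P := !![1, y, 0; 0, w, 0; 0, 0, 1]) ?_ fun t z => ?_
    · simpa [Matrix.det_fin_three] using hw
    · ext i j
      fin_cases i <;> fin_cases j <;>
        simp [stdMat, Matrix.mul_apply, Fin.sum_univ_three] <;> ring

/-- Dual to `exists_column`: the lower right block of P sends the row (x, y) to a multiple of (1,
0), and the corner of P absorbs the factor. -/
theorem Rep.IsStd.exists_row {φ : Rep k} {l m : ℤ} {x y : k} (h : φ.IsStd l m m x y 0)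
    (hxy : x ≠ 0 ∨ y ≠ 0) : ∃ ψ : Rep k, φ.Equivalent ψ ∧ ψ.IsStd l m m 1 0 0 := by
  by_cases hx : x = 0
  · have hy : y ≠ 0 := hxy.resolve_left (not_not.2 hx)
    refine h.exists_equivalent (P := !![y, 0, 0; 0, 0, 1; 0, 1, 0]) ?_ fun t z => ?_
    · simpa [Matrix.det_fin_three] using hy
    · ext i j
      fin_cases i <;> fin_cases j <;>
        simp [stdMat, Matrix.mul_apply, Fin.sum_univ_three, hx] <;> ring
  · refine h.exists_equivalent (P := !![x, 0, 0; 0, 1, -y; 0, 0, x]) ?_ fun t z => ?_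
    · simpa [Matrix.det_fin_three] using hx
    · ext i j
      fin_cases i <;> fin_cases j <;>
        simp [stdMat, Matrix.mul_apply, Fin.sum_univ_three] <;> ring

theorem Rep.IsStd.exists_normalForm (hp : p.Prime) {φ : Rep k} {l₁ l₂ l₃ : ℤ} {x y w : k}
    (h : φ.IsStd l₁ l₂ l₃ x y w) (hc : StdConstraints k p l₁ l₂ l₃ x y w) :
    ∃ (lam : NormalForm) (ψ : Rep k), φ.Equivalent ψ ∧ lam.Adm p l₁ l₂ l₃ ∧
      ψ.IsStd l₁ l₂ l₃ (lam.coeffs k).1 (lam.coeffs k).2.1 (lam.coeffs k).2.2 := by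
  obtain ⟨h0, h12, h23, hx, hw, hy, hb⟩ := hc
  have hpos : ∀ e : ℕ, (0 : ℤ) < 2 * (p : ℤ) ^ e := fun e => by
    have : (0 : ℤ) < p := by exact_mod_cast hp.pos
    positivity
  -- Equal adjacent weights kill the coefficient between them, because 2p^e is positive.
  have hx' : l₁ = l₂ → x = 0 := fun hl => by_contra fun hne => by
    obtain ⟨e, he⟩ := hx hne
    have := hpos e
    linarith
  have hw' : l₂ = l₃ → w = 0 := fun hl => by_contra fun hne => by
    obtain ⟨e, he⟩ := hw hne
    have := hpos e
    linarith
  have hrefl := (Rep.equivalent_equivalence k).refl φ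
  rcases h12.eq_or_lt with e12 | l12 <;> rcases h23.eq_or_lt with e23 | l23
  · have hy' : y = 0 := by_contra fun hne => by
      obtain ⟨e, he⟩ := hy (Or.inl (hx' e12.symm)) hne
      have := hpos e
      linarith
    rw [hx' e12.symm, hw' e23.symm, hy'] at h
    exact ⟨.XII, φ, hrefl, ⟨by linarith, by linarith, by linarith⟩, h⟩
  · subst e12
    obtain rfl := hx' rfl
    have hW : Weights₂ l₂ l₂ l₃ := ⟨h0, rfl, by linarith, by linarith⟩
    by_cases hyw : y = 0 ∧ w = 0
    · rw [hyw.1, hyw.2] at h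
      exact ⟨.VIII, φ, hrefl, hW, h⟩
    · have hyw' : y ≠ 0 ∨ w ≠ 0 := by tauto
      obtain ⟨ψ, h1, h2⟩ := h.exists_column hyw'
      exact ⟨.IX, ψ, h1, ⟨hW, hyw'.elim (hy (Or.inl rfl)) hw⟩, h2⟩
  · subst e23
    obtain rfl := hw' rfl
    have hW : Weights₃ l₁ l₃ l₃ := ⟨h0, by linarith, by linarith, rfl⟩
    by_cases hxy : x = 0 ∧ y = 0
    · rw [hxy.1, hxy.2] at h
      exact ⟨.X, φ, hrefl, hW, h⟩
    · have hxy' : x ≠ 0 ∨ y ≠ 0 := by tauto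
      obtain ⟨ψ, h1, h2⟩ := h.exists_row hxy'
      exact ⟨.XI, ψ, h1, ⟨hW, hxy'.elim hx (hy (Or.inr rfl))⟩, h2⟩
  · have hW : Weights₁ l₁ l₂ l₃ := ⟨h0, l12, l23, by linarith, by linarith⟩
    by_cases x0 : x = 0
    · subst x0
      by_cases w0 : w = 0
      · subst w0
        by_cases y0 : y = 0
        · subst y0
          exact ⟨.II, φ, hrefl, hW, h⟩
        · obtain ⟨ψ, h1, h2⟩ := h.exists_rescale (x' := 0) (y' := 1) (w' := 0) y 1 1
            (by simpa using y0) (by simp) (by simp) (by simp)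
          exact ⟨.IV, ψ, h1, ⟨hW, hy (Or.inl rfl) y0⟩, h2⟩
      · by_cases y0 : y = 0
        · obtain ⟨ψ, h1, h2⟩ := h.exists_rescale (x' := 0) (y' := 0) (w' := 1) 1 w 1
            (by simpa using w0) (by simp) (by simp [y0]) (by simp)
          exact ⟨.VI, ψ, h1, ⟨hW, hw w0⟩, h2⟩
        · obtain ⟨ψ, h1, h2⟩ := h.exists_rescale (x' := 0) (y' := 1) (w' := 1) y w 1
            (by simp [w0, y0]) (by simp) (by simp) (by simp)
          obtain ⟨e, he⟩ := hw w0
          obtain ⟨f, hf⟩ := hy (Or.inl rfl) y0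
          exact ⟨.VII, ψ, h1, ⟨hW, e, f, he, hf⟩, h2⟩
    · by_cases w0 : w = 0
      · by_cases y0 : y = 0
        · obtain ⟨ψ, h1, h2⟩ := h.exists_rescale (x' := 1) (y' := 0) (w' := 0) x 1 1
            (by simpa using x0) (by simp) (by simp [y0]) (by simp [w0])
          exact ⟨.III, ψ, h1, ⟨hW, hx x0⟩, h2⟩
        · obtain ⟨ψ, h1, h2⟩ := h.exists_rescale (x' := 1) (y' := 1) (w' := 0) 1 x⁻¹ y⁻¹
            (by simp [x0, y0]) (by simp [x0]) (by simp [y0]) (by simp [w0])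
          obtain ⟨e, he⟩ := hx x0
          obtain ⟨f, hf⟩ := hy (Or.inr w0) y0
          exact ⟨.V, ψ, h1, ⟨hW, e, f, he, hf⟩, h2⟩
      -- Equal spacing and zero sum give l₂ = 0; rescaling x and w to 1 turns y = xw/2 into 1/2.
      · obtain ⟨hl, hp2, hy'⟩ := hb x0 w0
        obtain ⟨ψ, h1, h2⟩ := h.exists_rescale (x' := 1) (y' := 2⁻¹) (w' := 1) (x * w) w 1
          (by simp [x0, w0]) (by simp) (by simp [hy']) (by simp)
        have hp3 : 3 ≤ p := by
          have := hp.two_le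
          omega
        exact ⟨.I, ψ, h1, ⟨hW, hp3, by linarith, hx x0⟩, h2⟩

theorem classMap_surjective [Infinite k] (hp : p.Prime) [CharP k p] :
    Function.Surjective (classMap k p) := by
  intro c
  induction c using Quotient.inductionOn with
  | h φ =>
    obtain ⟨ψ, l₁, l₂, l₃, x, y, w, h1, h2, h3⟩ := φ.exists_isStd hp
    obtain ⟨lam, χ, h4, h5, h6⟩ := h2.exists_normalForm hp h3
    have h7 : χ.HasForm p lam := (χ.hasForm_iff hp lam).2 ⟨l₁, l₂, l₃, h5, h6⟩
    have he := Rep.equivalent_equivalence k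
    exact ⟨⟨lam, χ, h7⟩, Quotient.sound (he.symm (he.trans h1 h4))⟩

end GaGm

theorem corollary2p4 (k : Type*) [Field k] [IsAlgClosed k] (p : ℕ) [Fact p.Prime] [CharP k p] :
    Function.Bijective (GaGm.classMap k p) := by
  have hp : p.Prime := Fact.out
  have : Infinite k := IsAlgClosed.instInfinite
  exact ⟨GaGm.classMap_injective hp, GaGm.classMap_surjective hp⟩
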